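/- Let $n,d\ge 1$ and let $W\in\mathbb R^{d\times d}$ have i.i.d. $\mathcal N(0,1/d)$ entries. For $X\in\mathbb R^{n\times d}$ with rows (tokens) $x_1,\dots,x_n$, let $s(X)=\mathrm{softmax}\big(XWX^\top/\sqrt d\big)\in\mathbb R^{n\times n}$, where $\mathrm{softmax}(u)_k=e^{u_k}/\sum_l e^{u_l}$ is applied to each row, and let $\varphi(X)=s(X)X$ be the random attention features map. For $i\in\{1,\dots,n\}$ and $\Delta\in\mathbb R^d$, let $X^i(\Delta)$ be $X$ with its $i$-th row replaced by $x_i+\Delta$, and define the word sensitivity $$\mathcal S_\varphi(X)=\sup_{1\le i\le n,\ \|\Delta\|_2\le\sqrt d}\frac{\|\varphi(X^i(\Delta))-\varphi(X)\|_F}{\|\varphi(X)\|_F}\in[0,\infty].$$ There are absolute constants $c,\kappa,\gamma,\eta>0$ such that for every $K>0$ there are $d_0\in\mathbb N$ and a sequence $r(d)=o(1/\sqrt d)$, both depending only on $K$, with the following property. Let $n\ge1$ and $d\ge d_0$ satisfy $d/\log^4 d\ge K n$, and let $X\in\mathbb R^{n\times d}$ be any fixed matrix with $\|x_j\|_2=\sqrt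 d$ for all $j$. Then, with probability at least $1-\exp(-c\log^2 d)$ over $W$, both of the following hold: 1. $\mathcal S_\varphi(X)\ge \kappa$. 2. For every $i\in\{1,\dots,n\}$ there is $\Delta^*\in\mathbb R^d$ with $\|\Delta^*\|_2\le\sqrt d$ such that $\big\|[s(X^i(\Delta^*))]_{j:}-e_i\big\|_2\le r(d)$ for at least $\gamma n$ indices $j$ (these rows of the attention concentrate on the perturbed token; $e_i$ is the $i$-th vector of the canonical basis of $\mathbb R^n$), and $\|\varphi(X^i(\Delta^*))-\varphi(X)\|_F\ge\eta\sqrt{dn}$. -/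

import Mathlib

open MeasureTheory ProbabilityTheory Filter Asymptotics
open scoped ENNReal NNReal

-- The norm of a matrix is its Frobenius norm.
attribute [local instance] Matrix.frobeniusNormedAddCommGroup

noncomputable section

/-- The product σ-algebra on real matrices, entry by entry. -/
instance matrixMeasurableSpace (m n : ℕ) : MeasurableSpace (Matrix (Fin m) (Fin n) ℝ) :=
  inferInstanceAs (MeasurableSpace (Fin m → Fin n → ℝ))

/-- The law of a `d × d` matrix with i.i.d. entries of distribution `N(0, 1 / d)`. -/
def gaussianMatrix (d : ℕ) : Measure (Matrix (Fin d) (Fin d) ℝ) :=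
  Measure.pi fun _ : Fin d => Measure.pi fun _ : Fin d => gaussianReal 0 (1 / (d : ℝ≥0))

/-- The softmax of a vector, `softmax(s)_k = exp(s_k) / ∑ l, exp(s_l)`. -/
def softmax {n : ℕ} (s : Fin n → ℝ) : Fin n → ℝ :=
  fun k => Real.exp (s k) / ∑ l, Real.exp (s l)

/-- The attention scores `softmax(X W Xᵀ / √d)`, the softmax being applied to each row. -/
def attentionScores {n d : ℕ} (W : Matrix (Fin d) (Fin d) ℝ) (X : Matrix (Fin n) (Fin d) ℝ) :
    Matrix (Fin n) (Fin n) ℝ :=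
  Matrix.of fun j => softmax (((1 / √(d : ℝ)) • (X * W * X.transpose)) j)

/-- The random attention features map `softmax(X W Xᵀ / √d) X`. -/
def raf {n d : ℕ} (W : Matrix (Fin d) (Fin d) ℝ) (X : Matrix (Fin n) (Fin d) ℝ) :
    Matrix (Fin n) (Fin d) ℝ :=
  attentionScores W X * X

/-- The perturbed sample: the `i`-th row `x_i` of `X` is replaced by `x_i + Δ`. -/
def perturb {n d : ℕ} (X : Matrix (Fin n) (Fin d) ℝ) (i : Fin n)
    (Δ : EuclideanSpace ℝ (Fin d)) : Matrix (Fin n) (Fin d) ℝ :=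
  X.updateRow i (X i + Δ.ofLp)

/-- The word sensitivity of a map `φ` at `X`: the supremum, over the token `i` and the
perturbations `Δ` of norm at most `√d`, of `‖φ(Xⁱ(Δ)) - φ(X)‖ / ‖φ(X)‖`, with values in
`[0, ∞]` (the supremum need not be finite for a general map). -/
def wordSensitivity {n d : ℕ} {E : Type*} [NormedAddCommGroup E]
    (φ : Matrix (Fin n) (Fin d) ℝ → E) (X : Matrix (Fin n) (Fin d) ℝ) : ℝ≥0∞ :=
  ⨆ (i : Fin n) (Δ : EuclideanSpace ℝ (Fin d)) (_ : ‖Δ‖ ≤ √(d : ℝ)),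
    ‖φ (perturb X i Δ) - φ X‖ₑ / ‖φ X‖ₑ

end

/-! Write `x_j = √d u_j` and `L = log d`. The perturbation is `Δ = (√d / 2) Wᵀ z`, where `z` is a
unit vector with `⟨u_j, z⟩ ≥ 1 / (2√n)` for a constant fraction of the `j` (`exists_unit_inner_ge`).
It exists because a random sign combination of an orthonormal basis of the span of the `u_j`, of
dimension at most `n`, has inner product of order `1 / √n` with each of them with constant
probability. As `z` depends on `X` and not on `W`, concentration applies to it.

With high probability `W` almost preserves the inner products of the `u_j` and the `z`'s, and its
bilinear form on them is small, both up to `t = L / √d` (`measure_gramEvent_ge`). Then `Δ` adds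
about `(√d / 2) ⟨u_j, z⟩ ≥ √d / (4√n) ≥ √K L² / 4` to the score of token `i` in row `j`, while all
unperturbed scores are at most `L` in absolute value. For large `d` the gap is at least `4L`, so
softmax puts all but a mass `n d⁻⁴` on token `i`.

Every token is nearly orthogonal to `Δ`, hence so are the old features, which are convex
combinations of tokens. The new row is close to `x_i + Δ`, so it moves by order `√d` along `Δ`
(`raf_perturb_sub_row_dotProduct_ge`). Summing over the rows gives `√(dn)`, the size that `‖φ(X)‖`
cannot exceed (`norm_raf_le`). -/

/-! ### Laws of linear images of a Gaussian matrix -/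

/-- `gaussianMatrix` is a product over rows, whereas the coordinates of `a ᵥ* W` are functions of
separate columns; transposing exposes their independence. -/
theorem map_swap_pi_pi {ι κ : Type*} [Fintype ι] [Fintype κ] (μ : Measure ℝ)
    [IsProbabilityMeasure μ] :
    (Measure.pi fun _ : ι => Measure.pi fun _ : κ => μ).map (fun w k i => w i k) =
      Measure.pi fun _ : κ => Measure.pi fun _ : ι => μ := by
  symm
  have hgen : ∀ k : κ, MeasurableSpace.generateFrom
      (Set.pi Set.univ '' Set.pi Set.univ fun _ : ι => {s : Set ℝ | MeasurableSet s}) =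
        MeasurableSpace.pi := fun _ => generateFrom_pi
  refine Measure.pi_eq_generateFrom hgen (fun _ => isPiSystem_pi)
    (fun _ => Measure.FiniteSpanningSetsIn.pi fun _ => μ.toFiniteSpanningSetsIn) ?_
  intro s hs
  choose t ht hts using hs
  have hmeas : Measurable (fun (w : ι → κ → ℝ) k i => w i k) := by fun_prop
  have htm : ∀ k i, MeasurableSet (t k i) := fun k i => ht k i (Set.mem_univ i)
  rw [Measure.map_apply hmeas]
  · have : (fun (w : ι → κ → ℝ) k i => w i k) ⁻¹' Set.univ.pi s =
        Set.univ.pi fun i => Set.univ.pi fun k => t k i := by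
      ext w
      simp only [Set.mem_preimage, Set.mem_pi, Set.mem_univ, true_imp_iff, ← hts]
      exact ⟨fun h i k => h k i, fun h k i => h i k⟩
    rw [this, Measure.pi_pi]
    simp only [Measure.pi_pi, ← hts]
    exact Finset.prod_comm
  · exact MeasurableSet.univ_pi fun k => (hts k) ▸ MeasurableSet.univ_pi (htm k)

theorem map_sum_mul_pi_gaussianReal {ι : Type*} [Fintype ι] (v : ℝ≥0) (a : ι → ℝ) :
    (Measure.pi fun _ : ι => gaussianReal 0 v).map (fun w => ∑ k, a k * w k) =
      gaussianReal 0 ((∑ k, (a k) ^ 2).toNNReal * v) := by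
  apply Measure.ext_of_charFun
  ext t
  rw [charFun_gaussianReal, charFun_apply_real,
    integral_map (Measurable.aemeasurable (by fun_prop)) (by fun_prop)]
  have h : ∀ w : ι → ℝ, Complex.exp (t * ((∑ k, a k * w k : ℝ) : ℂ) * Complex.I) =
      ∏ k, Complex.exp (((t * a k : ℝ) : ℂ) * (w k : ℂ) * Complex.I) := by
    intro w
    rw [← Complex.exp_sum]
    congr 1
    push_cast
    rw [Finset.mul_sum, Finset.sum_mul]
    exact Finset.sum_congr rfl fun k _ => by ring
  simp_rw [h]
  rw [integral_fintype_prod_eq_prod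
    (f := fun k (x : ℝ) => Complex.exp (((t * a k : ℝ) : ℂ) * (x : ℂ) * Complex.I))]
  simp_rw [← charFun_apply_real, charFun_gaussianReal]
  rw [← Complex.exp_sum]
  congr 1
  have h0 : (0:ℝ) ≤ ∑ k, (a k) ^ 2 := Finset.sum_nonneg fun k _ => sq_nonneg _
  simp only [NNReal.coe_mul, Real.coe_toNNReal _ h0]
  push_cast
  rw [Finset.sum_mul, Finset.sum_mul, Finset.sum_div]
  simp only [mul_zero, zero_mul, zero_sub, Finset.sum_neg_distrib]
  congr 1
  exact Finset.sum_congr rfl fun k _ => by ring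

open scoped Matrix in
theorem map_vecMul_gaussianMatrix (d : ℕ) (a : Fin d → ℝ) :
    (gaussianMatrix d).map (fun W => a ᵥ* W) =
      Measure.pi fun _ : Fin d => gaussianReal 0 ((∑ k, (a k) ^ 2).toNNReal * (1 / (d : ℝ≥0))) := by
  have h1 : (fun (W : Fin d → Fin d → ℝ) l => ∑ k, a k * W k l) =
      (fun (V : Fin d → Fin d → ℝ) l => ∑ k, a k * V l k) ∘ (fun W l k => W k l) := rfl
  change (Measure.pi fun _ : Fin d => Measure.pi fun _ : Fin d =>
    gaussianReal 0 (1 / (d : ℝ≥0))).map (fun (W : Fin d → Fin d → ℝ) l => ∑ k, a k * W k l) = _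
  rw [h1, ← Measure.map_map (by fun_prop) (by fun_prop), map_swap_pi_pi]
  rw [← map_sum_mul_pi_gaussianReal]
  have : ∀ _ : Fin d, IsProbabilityMeasure ((Measure.pi fun _ : Fin d =>
    gaussianReal 0 (1 / (d : ℝ≥0))).map (fun w => ∑ k, a k * w k)) :=
    fun _ => Measure.isProbabilityMeasure_map (Measurable.aemeasurable (by fun_prop))
  exact Measure.pi_map_pi (f := fun _ (w : Fin d → ℝ) => ∑ k, a k * w k)
    (fun _ => Measurable.aemeasurable (by fun_prop))

open scoped Matrix in
theorem measurable_vecMul {d : ℕ} (a : Fin d → ℝ) :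
    Measurable fun W : Matrix (Fin d) (Fin d) ℝ => a ᵥ* W := by
  change Measurable fun (W : Fin d → Fin d → ℝ) l => ∑ k, a k * W k l
  fun_prop

open scoped Matrix in
theorem map_vecMul_dotProduct_gaussianMatrix (d : ℕ) (a b : Fin d → ℝ) :
    (gaussianMatrix d).map (fun W => b ⬝ᵥ (a ᵥ* W)) =
      gaussianReal 0 ((∑ k, (b k) ^ 2).toNNReal *
        ((∑ k, (a k) ^ 2).toNNReal * (1 / (d : ℝ≥0)))) := by
  rw [← map_sum_mul_pi_gaussianReal, ← map_vecMul_gaussianMatrix,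
    Measure.map_map (by fun_prop) (measurable_vecMul a)]
  rfl

/-! ### Chi-square and Gaussian tail bounds -/

theorem integral_exp_mul_sq_gaussianReal {v : ℝ≥0} (hv : v ≠ 0) {s : ℝ} (hs : s < 1) :
    Integrable (fun x => Real.exp (s / (2 * v) * x ^ 2)) (gaussianReal 0 v) ∧
    ∫ x, Real.exp (s / (2 * v) * x ^ 2) ∂gaussianReal 0 v = (√(1 - s))⁻¹ := by
  have hv' : (0 : ℝ) < v := by positivity
  have hb : 0 < (1 - s) / (2 * v) := by
    have : 0 < 1 - s := by linarith
    positivity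
  have key : ∀ x : ℝ, gaussianPDFReal 0 v x * Real.exp (s / (2 * v) * x ^ 2) =
      (√(2 * Real.pi * v))⁻¹ * Real.exp (-((1 - s) / (2 * v)) * x ^ 2) := by
    intro x
    rw [gaussianPDFReal_def, mul_assoc, ← Real.exp_add]
    congr 2
    field_simp
    ring
  constructor
  · rw [gaussianReal_of_var_ne_zero _ hv]
    have hd : gaussianPDF 0 v = fun x => ENNReal.ofReal (gaussianPDFReal 0 v x) := rfl
    rw [hd]
    rw [integrable_withDensity_iff (by fun_prop) (by simp)]
    have := (integrable_exp_neg_mul_sq hb).const_mul (√(2 * Real.pi * v))⁻¹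
    refine this.congr (ae_of_all _ fun x => ?_)
    simp only
    rw [← key, ENNReal.toReal_ofReal (gaussianPDFReal_nonneg _ _ _), mul_comm]
  · rw [integral_gaussianReal_eq_integral_smul hv]
    simp only [smul_eq_mul, key]
    rw [integral_const_mul, integral_gaussian, ← Real.sqrt_inv, ← Real.sqrt_inv, ← Real.sqrt_mul (by positivity)]
    congr 1
    have : 1 - s ≠ 0 := by linarith
    field_simp

/-- This is `-log (1 - s) ≤ s + s²`, halved. Both signs of `s` serve: positive for the upper tail,
negative for the lower one. -/
theorem inv_sqrt_one_sub_le {s : ℝ} (hs : |s| ≤ 1 / 2) :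
    (√(1 - s))⁻¹ ≤ Real.exp (s / 2 + s ^ 2 / 2) := by
  obtain ⟨hs1, hs2⟩ := abs_le.1 hs
  have h1 : 1 ≤ Real.exp (s + s ^ 2) * (1 - s) := by
    rcases le_total 0 s with h | h
    · have h2 := Real.quadratic_le_exp_of_nonneg (x := s + s ^ 2) (by positivity)
      refine le_trans ?_ (mul_le_mul_of_nonneg_right h2 (by linarith))
      have : 0 ≤ s ^ 2 * (1 - s - s ^ 2 - s ^ 3) := by
        apply mul_nonneg (sq_nonneg s)
        nlinarith [mul_nonneg h h, mul_nonneg (mul_nonneg h h) h]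
      nlinarith
    · have h2 := Real.add_one_le_exp (s + s ^ 2)
      refine le_trans ?_ (mul_le_mul_of_nonneg_right h2 (by linarith))
      nlinarith [mul_nonneg (neg_nonneg.2 h) (sq_nonneg s)]
  have hpos : 0 < 1 - s := by linarith
  rw [inv_le_iff_one_le_mul₀ (Real.sqrt_pos.2 hpos)]
  have h3 : Real.exp (s / 2 + s ^ 2 / 2) = √(Real.exp (s + s ^ 2)) := by
    rw [← Real.exp_half]
    congr 1
    ring
  rw [h3, ← Real.sqrt_mul (Real.exp_pos _).le]
  exact Real.one_le_sqrt.2 h1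

theorem mgf_sum_sq_pi_gaussianReal_le {ι : Type*} [Fintype ι] {v : ℝ≥0} (hv : v ≠ 0) {s : ℝ}
    (hs : |s| ≤ 1 / 2) :
    Integrable (fun y : ι → ℝ => Real.exp (s / (2 * v) * ∑ l, y l ^ 2))
      (Measure.pi fun _ : ι => gaussianReal 0 v) ∧
    mgf (fun y : ι → ℝ => ∑ l, y l ^ 2) (Measure.pi fun _ : ι => gaussianReal 0 v) (s / (2 * v)) ≤
      Real.exp (Fintype.card ι * (s / 2 + s ^ 2 / 2)) := by
  have hs1 : s < 1 := by linarith [(abs_le.1 hs).2]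
  obtain ⟨hint, hval⟩ := integral_exp_mul_sq_gaussianReal hv hs1
  have h : ∀ y : ι → ℝ, Real.exp (s / (2 * v) * ∑ l, y l ^ 2) =
      ∏ l, Real.exp (s / (2 * v) * y l ^ 2) := by
    intro y
    rw [← Real.exp_sum, Finset.mul_sum]
  constructor
  · simp_rw [h]
    exact Integrable.fintype_prod fun _ => hint
  · simp_rw [mgf, h]
    rw [integral_fintype_prod_eq_pow (fun x : ℝ => Real.exp (s / (2 * v) * x ^ 2)), hval,
      Real.exp_nat_mul]
    exact pow_le_pow_left₀ (by positivity) (inv_sqrt_one_sub_le hs) _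

theorem measure_abs_sum_sq_sub_le {d : ℕ} {v : ℝ≥0} (hv : v ≠ 0) {t : ℝ} (ht0 : 0 ≤ t)
    (ht1 : t ≤ 1) :
    (Measure.pi fun _ : Fin d => gaussianReal 0 v).real
      {y | t * (d * v) < |∑ l, y l ^ 2 - d * v|} ≤ 2 * Real.exp (-(d * t ^ 2 / 8)) := by
  have hv' : (0 : ℝ) < v := by positivity
  -- Chernoff with `s = ± t / 2`, which minimises the exponent `d (s² / 2 ∓ s t / 2)` and gives `-d
  -- t² / 8`.
  obtain ⟨hi1, hm1⟩ := mgf_sum_sq_pi_gaussianReal_le (ι := Fin d) hv (s := t / 2)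
    (by rw [abs_of_nonneg (by positivity)]; linarith)
  obtain ⟨hi2, hm2⟩ := mgf_sum_sq_pi_gaussianReal_le (ι := Fin d) hv (s := -(t / 2))
    (by rw [abs_neg, abs_of_nonneg (by positivity)]; linarith)
  have h1 := measure_ge_le_exp_mul_mgf ((1 + t) * (d * v)) (by positivity) hi1
  have h2 := measure_le_le_exp_mul_mgf ((1 - t) * (d * v))
    (div_nonpos_of_nonpos_of_nonneg (by linarith) (by positivity)) hi2
  rw [Fintype.card_fin] at hm1 hm2
  have e1 := h1.trans (mul_le_mul_of_nonneg_left hm1 (Real.exp_pos _).le)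
  have e2 := h2.trans (mul_le_mul_of_nonneg_left hm2 (Real.exp_pos _).le)
  rw [← Real.exp_add] at e1 e2
  have r1 : -(t / 2 / (2 * (v : ℝ))) * ((1 + t) * (d * v)) + d * (t / 2 / 2 + (t / 2) ^ 2 / 2) =
      -(d * t ^ 2 / 8) := by
    field_simp
    ring
  have r2 : -(-(t / 2) / (2 * (v : ℝ))) * ((1 - t) * (d * v)) +
      d * (-(t / 2) / 2 + (-(t / 2)) ^ 2 / 2) = -(d * t ^ 2 / 8) := by
    field_simp
    ring
  rw [r1] at e1
  rw [r2] at e2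
  refine (measureReal_mono (s₂ := {y : Fin d → ℝ | (1 + t) * (d * v) ≤ ∑ l, y l ^ 2} ∪
    {y | ∑ l, y l ^ 2 ≤ (1 - t) * (d * v)}) ?_).trans
    ((measureReal_union_le _ _).trans (by linarith))
  intro y hy
  rcases lt_abs.1 (Set.mem_ofPred_eq ▸ hy) with h | h
  · left
    simp only [Set.mem_ofPred_eq]
    linarith
  · right
    simp only [Set.mem_ofPred_eq]
    linarith

theorem measure_abs_gaussianReal_le {v : ℝ≥0} (hv : v ≠ 0) {t : ℝ} (ht : 0 ≤ t) :
    (gaussianReal 0 v).real {x | t < |x|} ≤ 2 * Real.exp (-(t ^ 2 / (2 * v))) := by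
  have hv' : (0 : ℝ) < v := by positivity
  have hm : ∀ s, mgf id (gaussianReal 0 v) s = Real.exp (v * s ^ 2 / 2) := fun s => by
    rw [mgf_gaussianReal (μ := 0) (v := v) (by simp)]
    simp
  have hi : ∀ s, Integrable (fun x => Real.exp (s * id x)) (gaussianReal 0 v) :=
    fun s => integrable_exp_mul_gaussianReal s
  have e1 := measure_ge_le_exp_mul_mgf t (by positivity) (hi (t / v))
  have e2 := measure_le_le_exp_mul_mgf (-t) (by rw [neg_nonpos]; positivity) (hi (-(t / v)))
  rw [hm, ← Real.exp_add] at e1 e2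
  have r1 : -(t / (v : ℝ)) * t + v * (t / v) ^ 2 / 2 = -(t ^ 2 / (2 * v)) := by
    field_simp
    ring
  have r2 : -(-(t / (v : ℝ))) * (-t) + v * (-(t / v)) ^ 2 / 2 = -(t ^ 2 / (2 * v)) := by
    field_simp
    ring
  rw [r1] at e1
  rw [r2] at e2
  refine (measureReal_mono (s₂ := {x : ℝ | t ≤ id x} ∪ {x | id x ≤ -t}) ?_).trans
    ((measureReal_union_le _ _).trans (by linarith))
  intro x hx
  rcases lt_abs.1 (Set.mem_ofPred_eq ▸ hx) with h | h
  · left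
    exact h.le
  · right
    simp only [Set.mem_ofPred_eq, id]
    linarith

/-! ### Near-isometry of a Gaussian matrix on a finite family -/

instance isProbabilityMeasure_gaussianMatrix (d : ℕ) :
    IsProbabilityMeasure (gaussianMatrix d) :=
  inferInstanceAs (IsProbabilityMeasure (Measure.pi fun _ : Fin d => Measure.pi fun _ : Fin d =>
    gaussianReal 0 (1 / (d : ℝ≥0))))

open scoped Matrix in
theorem measure_abs_vecMul_sq_sub_le {d : ℕ} (a : Fin d → ℝ) {t : ℝ} (ht0 : 0 ≤ t) (ht1 : t ≤ 1) :
    (gaussianMatrix d).real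
      {W | t * (a ⬝ᵥ a) < |(a ᵥ* W) ⬝ᵥ (a ᵥ* W) - a ⬝ᵥ a|} ≤ 2 * Real.exp (-(d * t ^ 2 / 8)) := by
  rcases eq_or_ne a 0 with rfl | ha
  · simp only [Matrix.zero_vecMul, dotProduct_zero, sub_zero, abs_zero, mul_zero, lt_irrefl,
      Set.ofPred_false, measureReal_empty]
    positivity
  have hd : d ≠ 0 := by
    rintro rfl
    exact ha (Subsingleton.elim _ _)
  have hsum : ∑ k, a k ^ 2 = a ⬝ᵥ a := Finset.sum_congr rfl fun k _ => sq (a k)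
  have hpos : 0 < a ⬝ᵥ a := by
    rw [← hsum]
    obtain ⟨k, hk⟩ := Function.ne_iff.1 ha
    exact Finset.sum_pos' (fun k _ => sq_nonneg _) ⟨k, Finset.mem_univ k, sq_pos_of_ne_zero hk⟩
  set v : ℝ≥0 := (∑ k, (a k) ^ 2).toNNReal * (1 / (d : ℝ≥0)) with hv
  have hdv : (d : ℝ) * v = a ⬝ᵥ a := by
    rw [hv, hsum, NNReal.coe_mul, Real.coe_toNNReal _ hpos.le]
    push_cast
    field_simp
  have hv0 : v ≠ 0 := by
    intro h
    rw [h] at hdv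
    simp only [NNReal.coe_zero, mul_zero] at hdv
    linarith
  have h := measure_abs_sum_sq_sub_le (d := d) hv0 ht0 ht1
  rw [← map_vecMul_gaussianMatrix, map_measureReal_apply (measurable_vecMul a)
    (measurableSet_lt (by fun_prop) (by fun_prop)), hdv] at h
  convert h using 3
  ext W
  simp [dotProduct, Matrix.vecMul, sq]

open scoped Matrix in
theorem measure_abs_vecMul_dotProduct_le {d : ℕ} {a b : Fin d → ℝ} (ha : a ⬝ᵥ a = 1)
    (hb : b ⬝ᵥ b = 1) {t : ℝ} (ht0 : 0 ≤ t) :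
    (gaussianMatrix d).real {W | t < |(a ᵥ* W) ⬝ᵥ b|} ≤ 2 * Real.exp (-(d * t ^ 2 / 8)) := by
  have hd : d ≠ 0 := by
    rintro rfl
    simp at ha
  have hsum : ∀ a : Fin d → ℝ, ∑ k, a k ^ 2 = a ⬝ᵥ a :=
    fun a => Finset.sum_congr rfl fun k _ => sq (a k)
  have h := measure_abs_gaussianReal_le (v := 1 / (d : ℝ≥0)) (by simpa using hd) ht0
  have hmap := map_vecMul_dotProduct_gaussianMatrix d a b
  rw [hsum, hsum, ha, hb, Real.toNNReal_one, one_mul, one_mul] at hmap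
  have hmeas : Measurable fun W : Matrix (Fin d) (Fin d) ℝ => b ⬝ᵥ (a ᵥ* W) :=
    Finset.measurable_sum _ fun l _ =>
      ((measurable_pi_apply l).comp (measurable_vecMul a)).const_mul _
  rw [← hmap, map_measureReal_apply hmeas (measurableSet_lt (by fun_prop) (by fun_prop))] at h
  have hset : {W : Matrix (Fin d) (Fin d) ℝ | t < |(a ᵥ* W) ⬝ᵥ b|} =
      (fun W => b ⬝ᵥ (a ᵥ* W)) ⁻¹' {x | t < |x|} := by
    ext W
    simp only [dotProduct_comm _ b]
    rfl
  rw [hset]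
  -- The true exponent `d t² / 2` is weakened to match the chi-square bound.
  refine h.trans (mul_le_mul_of_nonneg_left (Real.exp_le_exp.2 ?_) two_pos.le)
  have h1 : (0 : ℝ) ≤ d * t ^ 2 := by positivity
  have h2 : t ^ 2 / (2 * ((1 / d : ℝ≥0) : ℝ)) = d * t ^ 2 / 2 := by
    push_cast
    field_simp
  rw [h2]
  linarith

open scoped Matrix in
/-- The event that the Gram matrix of `Wᵀ a_p` is entrywise close to that of `a_p`, and that the
bilinear form of `W` is entrywise small on the family `a`. -/
def gramEvent {ι : Type*} {d : ℕ} (a : ι → Fin d → ℝ) (t : ℝ) : Set (Matrix (Fin d) (Fin d) ℝ) :=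
  {W | ∀ p q, |(a p ᵥ* W) ⬝ᵥ (a q ᵥ* W) - a p ⬝ᵥ a q| ≤ t ∧ |(a p ᵥ* W) ⬝ᵥ a q| ≤ t}

theorem measurableSet_gramEvent {ι : Type*} [Fintype ι] {d : ℕ} (a : ι → Fin d → ℝ) (t : ℝ) :
    MeasurableSet (gramEvent a t) := by
  simp only [gramEvent, Set.ofPred_forall, Set.ofPred_and]
  have hm := fun p => measurable_vecMul (a p)
  have hc := fun p l => (measurable_pi_apply l).comp (hm p)
  refine MeasurableSet.iInter fun p => MeasurableSet.iInter fun q => MeasurableSet.inter ?_ ?_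
  · refine measurableSet_le (Measurable.abs (Measurable.sub_const ?_ _)) measurable_const
    exact Finset.measurable_sum _ fun l _ => (hc p l).mul (hc q l)
  · refine measurableSet_le (Measurable.abs ?_) measurable_const
    exact Finset.measurable_sum _ fun l _ => (hc p l).mul_const _

open scoped Matrix in
-- Polarisation reduces inner products to the norms of `a p ± a q`, so each pair costs three events
-- of probability at most `2 exp (-d t² / 8)`.
theorem measure_gramEvent_ge {ι : Type*} [Fintype ι] {d : ℕ} {a : ι → Fin d → ℝ}
    (ha : ∀ p, a p ⬝ᵥ a p = 1) {t : ℝ} (ht0 : 0 ≤ t) (ht1 : t ≤ 1) :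
    1 - 6 * (Fintype.card ι : ℝ) ^ 2 * Real.exp (-(d * t ^ 2 / 8)) ≤
      (gaussianMatrix d).real (gramEvent a t) := by
  set B : ι × ι → Set (Matrix (Fin d) (Fin d) ℝ) := fun p =>
    ({W | t * ((a p.1 + a p.2) ⬝ᵥ (a p.1 + a p.2)) < |((a p.1 + a p.2) ᵥ* W) ⬝ᵥ
      ((a p.1 + a p.2) ᵥ* W) - (a p.1 + a p.2) ⬝ᵥ (a p.1 + a p.2)|} ∪
    {W | t * ((a p.1 - a p.2) ⬝ᵥ (a p.1 - a p.2)) < |((a p.1 - a p.2) ᵥ* W) ⬝ᵥ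
      ((a p.1 - a p.2) ᵥ* W) - (a p.1 - a p.2) ⬝ᵥ (a p.1 - a p.2)|}) ∪
    {W | t < |(a p.1 ᵥ* W) ⬝ᵥ a p.2|} with hB
  have hBm : ∀ p, (gaussianMatrix d).real (B p) ≤ 6 * Real.exp (-(d * t ^ 2 / 8)) := by
    intro p
    have h1 := measure_abs_vecMul_sq_sub_le (a p.1 + a p.2) ht0 ht1
    have h2 := measure_abs_vecMul_sq_sub_le (a p.1 - a p.2) ht0 ht1
    have h3 := measure_abs_vecMul_dotProduct_le (ha p.1) (ha p.2) ht0
    refine (measureReal_union_le _ _).trans ?_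
    refine (add_le_add_left (measureReal_union_le _ _) _).trans ?_
    linarith
  have hsub : (gramEvent a t)ᶜ ⊆ ⋃ p, B p := by
    intro W hW
    by_contra hcon
    refine hW fun p q => ?_
    simp only [hB, Set.mem_iUnion, Set.mem_union, Set.mem_ofPred_eq, not_exists, not_or, not_lt]
      at hcon
    obtain ⟨⟨h1, h2⟩, h3⟩ := hcon (p, q)
    refine ⟨?_, h3⟩
    -- The squared norms of `a p + a q` and `a p - a q` sum to `4`, so the relative errors `t`
    -- combine to exactly `t` after division by `4`.
    simp only [Matrix.add_vecMul, Matrix.sub_vecMul, add_dotProduct, dotProduct_add,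
      sub_dotProduct, dotProduct_sub, ha, dotProduct_comm (a q) (a p),
      dotProduct_comm (a q ᵥ* W) (a p ᵥ* W)] at h1 h2
    rw [abs_le] at h1 h2 ⊢
    constructor <;> linarith
  have hle : (gaussianMatrix d).real (gramEvent a t)ᶜ ≤
      6 * (Fintype.card ι : ℝ) ^ 2 * Real.exp (-(d * t ^ 2 / 8)) := by
    refine (measureReal_mono hsub).trans ((measureReal_iUnion_fintype_le B).trans ?_)
    refine (Finset.sum_le_sum fun p _ => hBm p).trans (le_of_eq ?_)
    rw [Finset.sum_const, nsmul_eq_mul, Finset.card_univ, Fintype.card_prod]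
    push_cast
    ring
  rw [probReal_compl_eq_one_sub (measurableSet_gramEvent a t)] at hle
  linarith

/-! ### A direction correlated with many unit vectors -/

/-- A choice of signs for which the sum of the truncated moments is at least its average over all
signs, bounded with the Khintchine inequality for the fourth moment. -/
theorem exists_signs_moment_ge {ι : Type*} (s : Finset ι) (m : ℕ) :
    ∀ (a : ι → Fin m → ℝ) (b : ι → ℝ), ∃ ε : Fin m → ℝ, (∀ k, ε k ^ 2 = 1) ∧
      ∑ j ∈ s, (2 / 3 * (b j ^ 2 + ∑ k, a j k ^ 2) -
        1 / 9 * (b j ^ 4 + 6 * b j ^ 2 * ∑ k, a j k ^ 2 + 3 * (∑ k, a j k ^ 2) ^ 2)) ≤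
      ∑ j ∈ s, (2 / 3 * (b j + ∑ k, ε k * a j k) ^ 2 -
        1 / 9 * (b j + ∑ k, ε k * a j k) ^ 4) := by
  induction m with
  | zero =>
    intro a b
    exact ⟨0, fun k => k.elim0, by simp⟩
  | succ m ih =>
    intro a b
    obtain ⟨ε₁, h₁, h₁'⟩ := ih (fun j k => a j k.succ) (fun j => b j + a j 0)
    obtain ⟨ε₂, h₂, h₂'⟩ := ih (fun j k => a j k.succ) (fun j => b j - a j 0)
    set F : ℝ → ℝ → ℝ := fun b A => 2 / 3 * (b ^ 2 + A) - 1 / 9 * (b ^ 4 + 6 * b ^ 2 * A + 3 * A ^ 2)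
    -- Averaging over the first sign: the two sides differ by `2 / 9 * a j 0 ^ 4` for each `j`.
    have key : ∑ j ∈ s, F (b j) (∑ k, a j k ^ 2) ≤
        (∑ j ∈ s, F (b j + a j 0) (∑ k : Fin m, a j k.succ ^ 2) +
          ∑ j ∈ s, F (b j - a j 0) (∑ k : Fin m, a j k.succ ^ 2)) / 2 := by
      rw [← Finset.sum_add_distrib, Finset.sum_div]
      refine Finset.sum_le_sum fun j _ => ?_
      rw [Fin.sum_univ_succ]
      simp only [F]
      nlinarith [sq_nonneg (a j 0 ^ 2)]
    rcases le_total (∑ j ∈ s, F (b j - a j 0) (∑ k : Fin m, a j k.succ ^ 2))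
      (∑ j ∈ s, F (b j + a j 0) (∑ k : Fin m, a j k.succ ^ 2)) with h | h
    · refine ⟨Fin.cons 1 ε₁, fun k => ?_, ?_⟩
      · cases k using Fin.cases <;> simp [h₁]
      · have : ∑ j ∈ s, F (b j) (∑ k, a j k ^ 2) ≤
            ∑ j ∈ s, F (b j + a j 0) (∑ k : Fin m, a j k.succ ^ 2) := by linarith
        refine (this.trans h₁').trans (le_of_eq (Finset.sum_congr rfl fun j _ => ?_))
        simp only [Fin.sum_univ_succ, Fin.cons_zero, Fin.cons_succ, one_mul, ← add_assoc]
    · refine ⟨Fin.cons (-1) ε₂, fun k => ?_, ?_⟩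
      · cases k using Fin.cases <;> simp [h₂]
      · have : ∑ j ∈ s, F (b j) (∑ k, a j k ^ 2) ≤
            ∑ j ∈ s, F (b j - a j 0) (∑ k : Fin m, a j k.succ ^ 2) := by linarith
        refine (this.trans h₂').trans (le_of_eq (Finset.sum_congr rfl fun j _ => ?_))
        simp only [Fin.sum_univ_succ, Fin.cons_zero, Fin.cons_succ, neg_mul, one_mul, ← add_assoc,
          ← sub_eq_add_neg]

/-- A Paley–Zygmund argument: `2/3 y² - 1/9 y⁴` averages at least `1/3`, is at most `1` everywhere
and at most `1/6` where `|y| ≤ 1/2`. So `|y| ≥ 1/2` for a sixth of the indices, and one of `ε`, `-ε`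
makes `y ≥ 1/2` on half of these. -/
theorem exists_signs_card_le {ι : Type*} (s : Finset ι) {m : ℕ} (a : ι → Fin m → ℝ)
    (ha : ∀ j ∈ s, ∑ k, a j k ^ 2 = 1) :
    ∃ ε : Fin m → ℝ, (∀ k, ε k ^ 2 = 1) ∧ ∃ J ⊆ s, (s.card : ℝ) / 12 ≤ J.card ∧
      ∀ j ∈ J, 1 / 2 ≤ ∑ k, ε k * a j k := by
  obtain ⟨ε, hε, h⟩ := exists_signs_moment_ge s m a 0
  set y : ι → ℝ := fun j => ∑ k, ε k * a j k with hy
  have h1 : (s.card : ℝ) / 3 ≤ ∑ j ∈ s, (2 / 3 * y j ^ 2 - 1 / 9 * y j ^ 4) := by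
    refine le_trans (le_of_eq ?_) (h.trans (le_of_eq (Finset.sum_congr rfl fun j _ => by simp [hy])))
    rw [Finset.sum_congr rfl (g := fun _ => (1 / 3 : ℝ))]
    · simp [div_eq_mul_inv]
    · intro j hj
      rw [ha j hj]
      norm_num
  have h2 : ∀ j ∈ s, 2 / 3 * y j ^ 2 - 1 / 9 * y j ^ 4 ≤
      1 / 6 + ((if 1 / 2 ≤ y j then 1 else 0) + (if 1 / 2 ≤ -y j then 1 else 0)) := by
    intro j _
    have hq : 2 / 3 * y j ^ 2 - 1 / 9 * y j ^ 4 ≤ 1 := by nlinarith [sq_nonneg (y j ^ 2 / 3 - 1)]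
    split_ifs with h3 h4 h4
    · linarith
    · linarith
    · linarith
    · have : y j ^ 2 ≤ (1 / 2) ^ 2 := sq_le_sq' (by linarith) (by linarith)
      nlinarith [sq_nonneg (y j ^ 2)]
  have h3 := h1.trans (Finset.sum_le_sum h2)
  rw [Finset.sum_add_distrib, Finset.sum_add_distrib, Finset.sum_boole, Finset.sum_boole,
    Finset.sum_const, nsmul_eq_mul] at h3
  rcases le_total ((s.filter fun j => 1 / 2 ≤ -y j).card : ℝ)
    ((s.filter fun j => 1 / 2 ≤ y j).card : ℝ) with h4 | h4
  · refine ⟨ε, hε, _, Finset.filter_subset _ _, by linarith, fun j hj => (Finset.mem_filter.1 hj).2⟩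
  · refine ⟨-ε, fun k => by simp [hε], _, Finset.filter_subset (fun j => 1 / 2 ≤ -y j) _,
      by linarith, fun j hj => ?_⟩
    simpa [hy] using (Finset.mem_filter.1 hj).2

/-- For finitely many unit vectors there is a unit vector which has an inner product at least
`1 / (2 √n)` with a constant fraction of them. -/
theorem exists_unit_inner_ge {ι E : Type*} [NormedAddCommGroup E] [InnerProductSpace ℝ E]
    (s : Finset ι) (hs : s.Nonempty) (u : ι → E) (hu : ∀ j ∈ s, ‖u j‖ = 1) :
    ∃ z : E, ‖z‖ = 1 ∧ ∃ J ⊆ s, (s.card : ℝ) / 12 ≤ J.card ∧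
      ∀ j ∈ J, 1 / (2 * √(s.card : ℝ)) ≤ inner ℝ (u j) z := by
  classical
  -- Working in the span bounds the dimension by `s.card`, which makes the correlation `1 /
  -- √(s.card)` whatever the dimension of `E`.
  set S : Submodule ℝ E := Submodule.span ℝ ((s.image u : Finset E) : Set E) with hS
  have hmem : ∀ j ∈ s, u j ∈ S := fun j hj =>
    Submodule.subset_span (Finset.mem_coe.2 (Finset.mem_image_of_mem u hj))
  have : FiniteDimensional ℝ S := FiniteDimensional.span_finset ℝ _
  obtain ⟨m, hm⟩ : ∃ m, Module.finrank ℝ S = m := ⟨_, rfl⟩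
  let e := (stdOrthonormalBasis ℝ S).reindex (finCongr hm)
  have hm_le : m ≤ s.card := hm ▸ (finrank_span_finset_le_card _).trans Finset.card_image_le
  have hm_pos : 0 < m := by
    obtain ⟨j, hj⟩ := hs
    rw [← hm, Module.finrank_pos_iff_exists_ne_zero]
    refine ⟨⟨u j, hmem j hj⟩, fun h => ?_⟩
    have h0 : u j = 0 := congrArg Subtype.val h
    simpa [h0] using hu j hj
  have hm_pos' : (0 : ℝ) < m := by exact_mod_cast hm_pos
  obtain ⟨ε, hε, J, hJ, hcard, hJε⟩ := exists_signs_card_le s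
    (fun j k => inner ℝ (u j) (e k : E)) (fun j hj => by
      have h := e.sum_sq_norm_inner_left (⟨u j, hmem j hj⟩ : S)
      simp only [Real.norm_eq_abs, sq_abs, Submodule.coe_inner] at h
      rw [h]
      simp [hu j hj])
  refine ⟨(√(m : ℝ))⁻¹ • ((∑ k, ε k • e k : S) : E), ?_, J, hJ, hcard, fun j hj => ?_⟩
  · have h1 : ‖∑ k, ε k • e k‖ ^ 2 = m := by
      rw [← real_inner_self_eq_norm_sq, e.orthonormal.inner_sum]
      simp [← sq, hε]
    have h2 : ‖∑ k, ε k • e k‖ = √(m : ℝ) := by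
      rw [← h1, Real.sqrt_sq (norm_nonneg _)]
    rw [norm_smul, ← Submodule.coe_norm, h2, norm_inv, Real.norm_of_nonneg (Real.sqrt_nonneg _)]
    exact inv_mul_cancel₀ (Real.sqrt_pos.2 hm_pos').ne'
  · have h1 : inner ℝ (u j) ((∑ k, ε k • e k : S) : E) = ∑ k, ε k * inner ℝ (u j) (e k : E) := by
      rw [Submodule.coe_sum, inner_sum]
      simp [inner_smul_right]
    rw [inner_smul_right, h1]
    have h2 : √(m : ℝ) ≤ √(s.card : ℝ) := Real.sqrt_le_sqrt (by exact_mod_cast hm_le)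
    have h3 : 0 < √(m : ℝ) := Real.sqrt_pos.2 hm_pos'
    calc 1 / (2 * √(s.card : ℝ)) ≤ 1 / (2 * √(m : ℝ)) := by gcongr
      _ = (√(m : ℝ))⁻¹ * (1 / 2) := by field_simp
      _ ≤ _ := by gcongr; exact hJε j hj

/-! ### Softmax and the attention features -/

theorem softmax_nonneg {n : ℕ} (s : Fin n → ℝ) (k : Fin n) : 0 ≤ softmax s k :=
  div_nonneg (Real.exp_pos _).le (Finset.sum_nonneg fun _ _ => (Real.exp_pos _).le)

theorem sum_softmax {n : ℕ} [NeZero n] (s : Fin n → ℝ) : ∑ k, softmax s k = 1 := by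
  simp only [softmax]
  rw [← Finset.sum_div]
  exact div_self (Finset.sum_pos (fun _ _ => Real.exp_pos _) Finset.univ_nonempty).ne'

theorem softmax_le_exp_sub {n : ℕ} (s : Fin n → ℝ) (k i : Fin n) :
    softmax s k ≤ Real.exp (s k - s i) := by
  rw [Real.exp_sub]
  exact div_le_div_of_nonneg_left (Real.exp_pos _).le (Real.exp_pos _)
    (Finset.single_le_sum (f := fun l => Real.exp (s l)) (fun _ _ => (Real.exp_pos _).le)
      (Finset.mem_univ i))

theorem one_sub_softmax_le {n : ℕ} [NeZero n] {s : Fin n → ℝ} {i : Fin n} {g : ℝ}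
    (h : ∀ k, k ≠ i → s k ≤ s i - g) : 1 - softmax s i ≤ n * Real.exp (-g) := by
  rw [← sum_softmax s, ← Finset.sum_erase_eq_sub (Finset.mem_univ i)]
  calc ∑ k ∈ Finset.univ.erase i, softmax s k
      ≤ ∑ k ∈ Finset.univ.erase i, Real.exp (-g) := Finset.sum_le_sum fun k hk =>
        (softmax_le_exp_sub s k i).trans
          (Real.exp_le_exp.2 (by linarith [h k (Finset.ne_of_mem_erase hk)]))
    _ ≤ ∑ _k : Fin n, Real.exp (-g) := Finset.sum_le_sum_of_subset_of_nonneg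
        (Finset.erase_subset _ _) fun _ _ _ => (Real.exp_pos _).le
    _ = _ := by simp

/-- The `ℓ²` norm is at most the `ℓ¹` norm, which equals the right-hand side because the mass
missing at `i` sits on the other coordinates. -/
theorem norm_softmax_sub_single_le {n : ℕ} [NeZero n] (s : Fin n → ℝ) (i : Fin n) :
    ‖WithLp.toLp 2 (softmax s - Pi.single i 1)‖ ≤ 2 * (1 - softmax s i) := by
  have h0 : 0 ≤ 1 - softmax s i := by
    rw [← sum_softmax s, ← Finset.sum_erase_eq_sub (Finset.mem_univ i)]
    exact Finset.sum_nonneg fun k _ => softmax_nonneg s k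
  have h1 : ∀ x : EuclideanSpace ℝ (Fin n), ‖x‖ ≤ ∑ k, |x k| := fun x => by
    conv_lhs => rw [← (EuclideanSpace.basisFun (Fin n) ℝ).sum_repr x]
    refine (norm_sum_le _ _).trans (le_of_eq (Finset.sum_congr rfl fun k _ => ?_))
    simp [norm_smul]
  refine (h1 _).trans ?_
  rw [← Finset.add_sum_erase _ _ (Finset.mem_univ i)]
  have h2 : ∑ k ∈ Finset.univ.erase i, |(softmax s - Pi.single i 1 : Fin n → ℝ) k| =
      1 - softmax s i := by
    rw [← sum_softmax s, ← Finset.sum_erase_eq_sub (Finset.mem_univ i)]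
    refine Finset.sum_congr rfl fun k hk => ?_
    rw [Pi.sub_apply, Pi.single_eq_of_ne (Finset.ne_of_mem_erase hk), sub_zero,
      abs_of_nonneg (softmax_nonneg s k)]
  have h3 : |(softmax s - Pi.single i 1 : Fin n → ℝ) i| = 1 - softmax s i := by
    rw [Pi.sub_apply, Pi.single_eq_same, abs_sub_comm, abs_of_nonneg h0]
  exact (add_le_add h3.le h2.le).trans (two_mul _).symm.le

theorem frobenius_norm_sq {m n : ℕ} (M : Matrix (Fin m) (Fin n) ℝ) :
    ‖M‖ ^ 2 = ∑ j, M j ⬝ᵥ M j := by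
  have h0 : 0 ≤ ∑ i, ∑ j, ‖M i j‖ ^ (2 : ℝ) := by positivity
  rw [Matrix.frobenius_norm_def, ← Real.sqrt_eq_rpow, Real.sq_sqrt h0]
  refine Finset.sum_congr rfl fun i _ => Finset.sum_congr rfl fun j _ => ?_
  rw [Real.rpow_two, Real.norm_eq_abs, sq_abs, sq]

theorem sq_dotProduct_le {n : ℕ} (x y : Fin n → ℝ) : (x ⬝ᵥ y) ^ 2 ≤ (x ⬝ᵥ x) * (y ⬝ᵥ y) := by
  have := Finset.sum_mul_sq_le_sq_mul_sq Finset.univ x y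
  simpa only [dotProduct, sq] using this

theorem norm_toLp_sq {n : ℕ} (x : Fin n → ℝ) : ‖WithLp.toLp 2 x‖ ^ 2 = x ⬝ᵥ x := by
  rw [EuclideanSpace.norm_sq_eq]
  exact Finset.sum_congr rfl fun k _ => by simp [sq]

theorem raf_row_dotProduct {n d : ℕ} (W : Matrix (Fin d) (Fin d) ℝ) (X : Matrix (Fin n) (Fin d) ℝ)
    (j : Fin n) (v : Fin d → ℝ) :
    raf W X j ⬝ᵥ v = ∑ k, attentionScores W X j k * (X k ⬝ᵥ v) := by
  simp only [raf, dotProduct, Matrix.mul_apply, Finset.sum_mul, Finset.mul_sum]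
  rw [Finset.sum_comm]
  exact Finset.sum_congr rfl fun k _ => Finset.sum_congr rfl fun l _ => mul_assoc _ _ _

/-- Each row is a convex combination of vectors of norm `√d`. -/
theorem norm_raf_le {n d : ℕ} [NeZero n] (W : Matrix (Fin d) (Fin d) ℝ)
    {X : Matrix (Fin n) (Fin d) ℝ} (hX : ∀ j, X j ⬝ᵥ X j = d) :
    ‖raf W X‖ ≤ √((d : ℝ) * n) := by
  refine Real.le_sqrt_of_sq_le ?_
  rw [frobenius_norm_sq]
  have h : ∀ j, raf W X j ⬝ᵥ raf W X j ≤ d := by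
    intro j
    set q := raf W X j ⬝ᵥ raf W X j with hq
    have hq0 : 0 ≤ q := Finset.sum_nonneg fun _ _ => mul_self_nonneg _
    have hk : ∀ k, X k ⬝ᵥ raf W X j ≤ √(d * q) := fun k => by
      refine Real.le_sqrt_of_sq_le ?_
      rw [← hX k]
      exact sq_dotProduct_le _ _
    have h1 : q ≤ √(d * q) := by
      conv_lhs => rw [hq, raf_row_dotProduct]
      refine (Finset.sum_le_sum fun k _ =>
        mul_le_mul_of_nonneg_left (hk k) (softmax_nonneg _ k)).trans ?_
      rw [← Finset.sum_mul]
      exact (congrArg (· * _) (sum_softmax _)).le.trans (one_mul _).le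
    have h2 : q * q ≤ d * q := by
      have := mul_self_le_mul_self hq0 h1
      rwa [Real.mul_self_sqrt (by positivity)] at this
    rcases hq0.eq_or_lt with h3 | h3
    · rw [← h3]
      positivity
    · exact le_of_mul_le_mul_right h2 h3
  refine (Finset.sum_le_sum fun j _ => h j).trans (le_of_eq ?_)
  simp [mul_comm]

/-- If the row `j` of the attention scores concentrates on a perturbed token, the perturbation
moves the row `j` of the attention features along `Δ`. -/
theorem raf_perturb_sub_row_dotProduct_ge {n d : ℕ} [NeZero n] {W : Matrix (Fin d) (Fin d) ℝ}
    {X : Matrix (Fin n) (Fin d) ℝ} {i j : Fin n} {Δ : EuclideanSpace ℝ (Fin d)} {B δ : ℝ}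
    (hB : ∀ k, |X k ⬝ᵥ Δ.ofLp| ≤ B)
    (hδ : 1 - δ ≤ attentionScores W (perturb X i Δ) j i) :
    (1 - δ) * (Δ.ofLp ⬝ᵥ Δ.ofLp) - 2 * B ≤
      (raf W (perturb X i Δ) - raf W X) j ⬝ᵥ Δ.ofLp := by
  have hrow : (raf W (perturb X i Δ) - raf W X) j = raf W (perturb X i Δ) j - raf W X j := rfl
  rw [hrow, sub_dotProduct, raf_row_dotProduct, raf_row_dotProduct]
  have hΔ : 0 ≤ Δ.ofLp ⬝ᵥ Δ.ofLp := Finset.sum_nonneg fun _ _ => mul_self_nonneg _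
  have hs : ∀ Y : Matrix (Fin n) (Fin d) ℝ, ∑ k, attentionScores W Y j k = 1 :=
    fun Y => sum_softmax _
  have h0 : ∀ (Y : Matrix (Fin n) (Fin d) ℝ) k, 0 ≤ attentionScores W Y j k :=
    fun Y k => softmax_nonneg _ k
  have h1 : ∑ k, attentionScores W X j k * (X k ⬝ᵥ Δ.ofLp) ≤ B := by
    refine (Finset.sum_le_sum fun k _ =>
      mul_le_mul_of_nonneg_left (abs_le.1 (hB k)).2 (h0 X k)).trans ?_
    rw [← Finset.sum_mul, hs, one_mul]
  have h2 : attentionScores W (perturb X i Δ) j i * (Δ.ofLp ⬝ᵥ Δ.ofLp) - B ≤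
      ∑ k, attentionScores W (perturb X i Δ) j k * (perturb X i Δ k ⬝ᵥ Δ.ofLp) := by
    have h3 : ∀ k, perturb X i Δ k ⬝ᵥ Δ.ofLp =
        X k ⬝ᵥ Δ.ofLp + if k = i then Δ.ofLp ⬝ᵥ Δ.ofLp else 0 := by
      intro k
      rw [perturb]
      split_ifs with h
      · subst h
        rw [Matrix.updateRow_self, add_dotProduct]
      · rw [Matrix.updateRow_ne h, add_zero]
    simp only [h3, mul_add, Finset.sum_add_distrib, mul_ite, mul_zero, Finset.sum_ite_eq',
      Finset.mem_univ, if_true]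
    have h4 : -B ≤ ∑ k, attentionScores W (perturb X i Δ) j k * (X k ⬝ᵥ Δ.ofLp) := by
      refine le_trans ?_ (Finset.sum_le_sum fun k _ =>
        mul_le_mul_of_nonneg_left (abs_le.1 (hB k)).1 (h0 (perturb X i Δ) k))
      rw [← Finset.sum_mul, hs, one_mul]
    linarith
  have := mul_le_mul_of_nonneg_right hδ hΔ
  linarith

/-! ### The attention-capturing perturbation -/

open scoped Matrix in
theorem attentionScores_row {n d : ℕ} (W : Matrix (Fin d) (Fin d) ℝ)
    (X : Matrix (Fin n) (Fin d) ℝ) (j : Fin n) :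
    attentionScores W X j = softmax fun k => 1 / √(d : ℝ) * ((X j ᵥ* W) ⬝ᵥ X k) := rfl

/-- Row `i` is excluded from `J` because perturbing token `i` also changes its query; `(n - 1) / 12
≥ n / 24` once `n ≥ 2`. For `n = 1` the attention is trivially `1`, so `J = {i}` works and the
quantifier over `k ≠ i` makes the last condition vacuous. -/
theorem exists_unit_dotProduct_ge {n d : ℕ} {u : Fin n → Fin d → ℝ}
    (hu : ∀ j, u j ⬝ᵥ u j = 1) (i : Fin n) :
    ∃ z : Fin d → ℝ, z ⬝ᵥ z = 1 ∧ ∃ J : Finset (Fin n), (n : ℝ) / 24 ≤ J.card ∧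
      ∀ j ∈ J, ∀ k, k ≠ i → j ≠ i ∧ 1 / (2 * √(n : ℝ)) ≤ u j ⬝ᵥ z := by
  have hn : 0 < n := i.pos
  rcases (Nat.succ_le_of_lt hn).eq_or_lt with h1 | h1
  · subst h1
    exact ⟨u i, hu i, {i}, by norm_num, fun j _ k hk => (hk (Subsingleton.elim _ _)).elim⟩
  have hcard : ((Finset.univ.erase i).card : ℝ) = n - 1 := by
    rw [Finset.card_erase_of_mem (Finset.mem_univ i), Finset.card_univ, Fintype.card_fin,
      Nat.cast_sub hn, Nat.cast_one]
  have h2 : (2 : ℝ) ≤ n := by exact_mod_cast h1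
  obtain ⟨z, hz, J, hJ, hJc, hJz⟩ := exists_unit_inner_ge (Finset.univ.erase i)
    (Finset.card_pos.1 (by
      have : (0 : ℝ) < (Finset.univ.erase i).card := by rw [hcard]; linarith
      exact_mod_cast this))
    (fun j => WithLp.toLp 2 (u j)) (fun j _ => by
      have := norm_toLp_sq (u j)
      rw [hu j] at this
      exact (pow_eq_one_iff_of_nonneg (norm_nonneg _) two_ne_zero).1 this)
  refine ⟨z.ofLp, ?_, J, ?_, fun j hj k _ => ⟨Finset.ne_of_mem_erase (hJ hj), ?_⟩⟩
  · rw [← norm_toLp_sq, WithLp.toLp_ofLp, hz, one_pow]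
  · rw [hcard] at hJc
    linarith
  · have h3 := hJz j hj
    rw [hcard] at h3
    have h4 : inner ℝ (WithLp.toLp 2 (u j)) z = u j ⬝ᵥ z.ofLp := by
      simp [PiLp.inner_apply, dotProduct, mul_comm]
    rw [h4] at h3
    refine le_trans ?_ h3
    have : 0 < √((n : ℝ) - 1) := Real.sqrt_pos.2 (by linarith)
    gcongr
    linarith

open scoped Matrix in
/-- On the event where `W` acts almost isometrically on the tokens and on a direction `z`
correlated with many of them, the perturbation `√d / 2 • Wᵀ z` attracts the attention of these
tokens. -/
theorem exists_perturbation {n d : ℕ} {W : Matrix (Fin d) (Fin d) ℝ}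
    {X : Matrix (Fin n) (Fin d) ℝ} {u : Fin n → Fin d → ℝ} {z : Fin d → ℝ} {i : Fin n}
    {J : Finset (Fin n)} {L t q : ℝ} (hd : 24 ≤ d) (hnd : n ≤ d) (hL : L = Real.log d)
    (ht : t * √(d : ℝ) = L) (ht1 : t ≤ 1 / 12) (hq : 26 ≤ q * L)
    (hqn : q * L ^ 2 * √(n : ℝ) ≤ √(d : ℝ))
    (hXu : ∀ j, X j = √(d : ℝ) • u j)
    (hJc : (n : ℝ) / 24 ≤ J.card)
    (hJ : ∀ j ∈ J, ∀ k, k ≠ i → j ≠ i ∧ 1 / (2 * √(n : ℝ)) ≤ u j ⬝ᵥ z)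
    (huz : ∀ j, |(u j ᵥ* W) ⬝ᵥ (z ᵥ* W) - u j ⬝ᵥ z| ≤ t)
    (hzz : |(z ᵥ* W) ⬝ᵥ (z ᵥ* W) - 1| ≤ t)
    (huu : ∀ j k, |(u j ᵥ* W) ⬝ᵥ u k| ≤ t) (hzu : ∀ k, |(z ᵥ* W) ⬝ᵥ u k| ≤ t) :
    ∃ Δ : EuclideanSpace ℝ (Fin d), ‖Δ‖ ≤ √(d : ℝ) ∧
      (∀ j ∈ J, ‖WithLp.toLp 2 (attentionScores W (perturb X i Δ) j - Pi.single i 1)‖ ≤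
        1 / (d : ℝ)) ∧
      1 / 30 * √((d : ℝ) * n) ≤ ‖raf W (perturb X i Δ) - raf W X‖ := by
  have hn : 0 < n := i.pos
  have : NeZero n := ⟨hn.ne'⟩
  have hd' : (24 : ℝ) ≤ d := by exact_mod_cast hd
  have hd0 : (0 : ℝ) < d := by linarith
  have hsd : 0 < √(d : ℝ) := Real.sqrt_pos.2 hd0
  have hsq : √(d : ℝ) * √(d : ℝ) = d := Real.mul_self_sqrt hd0.le
  have hsn : 0 < √(n : ℝ) := Real.sqrt_pos.2 (by exact_mod_cast hn)
  have hn' : (n : ℝ) ≤ d := by exact_mod_cast hnd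
  have hL0 : 0 < L := hL ▸ Real.log_pos (by linarith)
  obtain ⟨hzz1, hzz2⟩ := abs_le.1 hzz
  -- The factor `1 / 2` leaves room for the distortion of `‖Wᵀ z‖` within the budget `√d`.
  set Δ : EuclideanSpace ℝ (Fin d) := WithLp.toLp 2 ((√(d : ℝ) / 2) • (z ᵥ* W)) with hΔ
  have hΔo : Δ.ofLp = (√(d : ℝ) / 2) • (z ᵥ* W) := rfl
  have hΔΔ : Δ.ofLp ⬝ᵥ Δ.ofLp = d / 4 * ((z ᵥ* W) ⬝ᵥ (z ᵥ* W)) := by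
    rw [hΔo, smul_dotProduct, dotProduct_smul, smul_eq_mul, smul_eq_mul]
    linear_combination (1 / 4) * ((z ᵥ* W) ⬝ᵥ (z ᵥ* W)) * hsq
  have hΔ1 : d * (11 / 48) ≤ Δ.ofLp ⬝ᵥ Δ.ofLp := by
    rw [hΔΔ]
    nlinarith
  have hΔ2 : Δ.ofLp ⬝ᵥ Δ.ofLp ≤ d / 2 := by
    rw [hΔΔ]
    nlinarith
  have hB : ∀ k, |X k ⬝ᵥ Δ.ofLp| ≤ d / 24 := by
    intro k
    rw [hXu, hΔo, smul_dotProduct, dotProduct_smul, smul_eq_mul, smul_eq_mul,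
      dotProduct_comm (u k), ← mul_assoc, mul_div_assoc', hsq, abs_mul, abs_of_pos (by positivity)]
    have := (hzu k).trans ht1
    nlinarith
  have hexp : Real.exp (-(4 * L)) = 1 / (d : ℝ) ^ 4 := by
    rw [hL, Real.exp_neg, one_div]
    congr 1
    have h := Real.exp_nat_mul (Real.log d) 4
    rw [Real.exp_log hd0] at h
    exact_mod_cast h
  have hpow : n * Real.exp (-(4 * L)) ≤ 1 / (2 * d) := by
    rw [hexp, mul_one_div, div_le_div_iff₀ (by positivity) (by positivity), one_mul]
    have h1 : (2 : ℝ) ≤ d ^ 2 := by nlinarith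
    calc (n : ℝ) * (2 * d) ≤ d * (d ^ 2 * d) := by gcongr
      _ = d ^ 4 := by ring
  have hconc : ∀ j ∈ J, 1 - attentionScores W (perturb X i Δ) j i ≤ 1 / (2 * d) := by
    intro j hj
    refine le_trans ?_ hpow
    rw [attentionScores_row]
    refine one_sub_softmax_le fun k hk => ?_
    obtain ⟨hji, hz⟩ := hJ j hj k hk
    have e1 : perturb X i Δ j = X j := Matrix.updateRow_ne hji
    have e2 : perturb X i Δ k = X k := Matrix.updateRow_ne hk
    have e3 : perturb X i Δ i = X i + Δ.ofLp := Matrix.updateRow_self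
    have huu' : ∀ k, 1 / √(d : ℝ) * ((X j ᵥ* W) ⬝ᵥ X k) = √(d : ℝ) * ((u j ᵥ* W) ⬝ᵥ u k) := by
      intro k
      rw [hXu, hXu, Matrix.smul_vecMul, smul_dotProduct, dotProduct_smul, smul_eq_mul, smul_eq_mul]
      field_simp
    have huz' : 1 / √(d : ℝ) * ((X j ᵥ* W) ⬝ᵥ Δ.ofLp) =
        √(d : ℝ) / 2 * ((u j ᵥ* W) ⬝ᵥ (z ᵥ* W)) := by
      rw [hXu, hΔo, Matrix.smul_vecMul, smul_dotProduct, dotProduct_smul, smul_eq_mul, smul_eq_mul]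
      field_simp
    rw [e1, e2, e3, dotProduct_add, mul_add, huu', huu', huz']
    have b1 : √(d : ℝ) * ((u j ᵥ* W) ⬝ᵥ u k) ≤ L := by
      rw [← ht, mul_comm t]
      exact mul_le_mul_of_nonneg_left (abs_le.1 (huu j k)).2 hsd.le
    have b2 : -L ≤ √(d : ℝ) * ((u j ᵥ* W) ⬝ᵥ u i) := by
      rw [← ht, mul_comm t, ← mul_neg]
      exact mul_le_mul_of_nonneg_left (abs_le.1 (huu j i)).1 hsd.le
    have b3 : √(d : ℝ) / 2 * (1 / (2 * √(n : ℝ)) - t) ≤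
        √(d : ℝ) / 2 * ((u j ᵥ* W) ⬝ᵥ (z ᵥ* W)) :=
      mul_le_mul_of_nonneg_left (by linarith [(abs_le.1 (huz j)).1]) (by positivity)
    have b4 : √(d : ℝ) / 2 * (1 / (2 * √(n : ℝ)) - t) =
        1 / 4 * (√(d : ℝ) / √(n : ℝ)) - L / 2 := by
      rw [← ht]
      field_simp
      ring
    -- The gap is at least `26 L / 4 - L / 2 - 2 L = 4 L`; this fixes the constant `26`.
    have b5 : q * L ^ 2 ≤ √(d : ℝ) / √(n : ℝ) := (le_div_iff₀ hsn).2 hqn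
    have b6 : 26 * L ≤ q * L ^ 2 := by nlinarith
    linarith
  refine ⟨Δ, ?_, fun j hj => ?_, ?_⟩
  · refine Real.le_sqrt_of_sq_le ?_
    have := norm_toLp_sq Δ.ofLp
    rw [WithLp.toLp_ofLp] at this
    linarith
  · refine (norm_softmax_sub_single_le _ i).trans ?_
    have h1 := hconc j hj
    have h2 : 1 / (d : ℝ) = 2 * (1 / (2 * d)) := by field_simp
    rw [h2]
    exact mul_le_mul_of_nonneg_left h1 two_pos.le
  · have hrow : ∀ j ∈ J, (d : ℝ) / 32 ≤ (raf W (perturb X i Δ) - raf W X) j ⬝ᵥ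
        (raf W (perturb X i Δ) - raf W X) j := by
      intro j hj
      have h1 := hconc j hj
      have h2 : 1 / (2 * (d : ℝ)) ≤ 1 / 24 := by
        apply one_div_le_one_div_of_le <;> linarith
      have h3 := raf_perturb_sub_row_dotProduct_ge (W := W) (i := i) (δ := 1 / 24) (j := j) hB (by linarith)
      -- Numerically, `(23 / 24) (11 / 48) - 2 / 24 > 1 / 8`. Cauchy–Schwarz with `‖Δ‖² ≤ d / 2`
      -- then gives `d / 32`.
      have h4 : (d : ℝ) / 8 ≤ (raf W (perturb X i Δ) - raf W X) j ⬝ᵥ Δ.ofLp := by linarith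
      have h5 := sq_dotProduct_le ((raf W (perturb X i Δ) - raf W X) j) Δ.ofLp
      set D := (raf W (perturb X i Δ) - raf W X) j ⬝ᵥ (raf W (perturb X i Δ) - raf W X) j
      have hD : 0 ≤ D := Finset.sum_nonneg fun _ _ => mul_self_nonneg _
      have h6 : ((d : ℝ) / 8) ^ 2 ≤ D * (d / 2) :=
        (pow_le_pow_left₀ (by positivity) h4 2).trans
          (h5.trans (mul_le_mul_of_nonneg_left hΔ2 hD))
      by_contra hcon
      push Not at hcon
      nlinarith
    refine le_of_pow_le_pow_left₀ two_ne_zero (norm_nonneg _) ?_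
    rw [frobenius_norm_sq, mul_pow, Real.sq_sqrt (by positivity)]
    calc (1 / 30 : ℝ) ^ 2 * (d * n) ≤ n / 24 * (d / 32) := by
          have : (0 : ℝ) ≤ d * n := by positivity
          linarith
      _ ≤ J.card * (d / 32) := by gcongr
      _ = ∑ _j ∈ J, (d : ℝ) / 32 := by rw [Finset.sum_const, nsmul_eq_mul]
      _ ≤ ∑ j ∈ J, (raf W (perturb X i Δ) - raf W X) j ⬝ᵥ (raf W (perturb X i Δ) - raf W X) j :=
          Finset.sum_le_sum hrow
      _ ≤ _ := Finset.sum_le_sum_of_subset_of_nonneg (Finset.subset_univ J) fun j _ _ =>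
          Finset.sum_nonneg fun _ _ => mul_self_nonneg _

theorem wordSensitivity_raf_ge {n d : ℕ} [NeZero n] {W : Matrix (Fin d) (Fin d) ℝ}
    {X : Matrix (Fin n) (Fin d) ℝ} (hX : ∀ j, X j ⬝ᵥ X j = d) {i : Fin n}
    {Δ : EuclideanSpace ℝ (Fin d)} (hΔ : ‖Δ‖ ≤ √(d : ℝ)) {η : ℝ} (hη : 0 < η) (hd : 0 < d)
    (h : η * √((d : ℝ) * n) ≤ ‖raf W (perturb X i Δ) - raf W X‖) :
    ENNReal.ofReal η ≤ wordSensitivity (raf W) X := by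
  refine le_trans ?_ (le_iSup_of_le i (le_iSup_of_le Δ (le_iSup_of_le hΔ le_rfl)))
  have hn : 0 < n := NeZero.pos n
  have hs : 0 < √((d : ℝ) * n) := Real.sqrt_pos.2 (by positivity)
  -- If `φ(X) = 0`, a nonzero numerator makes the quotient `∞`, and not `0 / 0 = 0`.
  have hne : ‖raf W (perturb X i Δ) - raf W X‖ₑ ≠ 0 := by
    rw [enorm_ne_zero, ← norm_pos_iff]
    exact (mul_pos hη hs).trans_le h
  rw [ENNReal.le_div_iff_mul_le (Or.inr hne) (Or.inl enorm_ne_top)]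
  rw [← ofReal_norm, ← ofReal_norm, ← ENNReal.ofReal_mul hη.le]
  exact ENNReal.ofReal_le_ofReal
    ((mul_le_mul_of_nonneg_left (norm_raf_le W hX) hη.le).trans h)

/-! ### Asymptotics, union bound and conclusion -/

theorem eventually_log_le_sqrt {ε : ℝ} (hε : 0 < ε) :
    ∀ᶠ d : ℕ in atTop, Real.log d ≤ ε * √(d : ℝ) := by
  have h := (isLittleO_log_rpow_atTop (r := 1 / 2) (by norm_num)).comp_tendsto
    (tendsto_natCast_atTop_atTop (R := ℝ))
  filter_upwards [h.bound hε, eventually_ge_atTop 1] with d hd _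
  simp only [Function.comp_apply, Real.norm_eq_abs, ← Real.sqrt_eq_rpow] at hd
  rw [abs_of_nonneg (Real.sqrt_nonneg _)] at hd
  exact (le_abs_self _).trans hd

theorem isLittleO_inv_inv_sqrt :
    (fun d : ℕ => 1 / (d : ℝ)) =o[atTop] fun d : ℕ => 1 / √(d : ℝ) := by
  have h : Tendsto (fun d : ℕ => √(d : ℝ)) atTop atTop :=
    Real.tendsto_sqrt_atTop.comp tendsto_natCast_atTop_atTop
  refine (isLittleO_iff_tendsto' ?_).2 ?_
  · filter_upwards [eventually_ge_atTop 1] with d hd h0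
    have : 0 < √(d : ℝ) := Real.sqrt_pos.2 (by exact_mod_cast hd)
    exact absurd h0 (one_div_pos.2 this).ne'
  · refine h.inv_tendsto_atTop.congr' ?_
    filter_upwards with d
    rw [Pi.inv_apply, div_div_div_eq, one_mul, mul_one, Real.sqrt_div_self]

theorem union_bound_le_exp {n d : ℕ} (hnd : n ≤ d) (hd : 0 < d) (hL : 34 ≤ Real.log d) :
    6 * ((2 * n : ℕ) : ℝ) ^ 2 * Real.exp (-(Real.log d ^ 2 / 8)) ≤
      Real.exp (-(1 / 16) * Real.log d ^ 2) := by
  set L := Real.log d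
  have hd' : (0 : ℝ) < d := by exact_mod_cast hd
  have h1 : (24 : ℝ) ≤ Real.exp 4 := by
    have h2 : (2.7 : ℝ) ≤ Real.exp 1 := by linarith [Real.exp_one_gt_d9]
    have h3 := Real.exp_nat_mul 1 4
    have h4 := pow_le_pow_left₀ (by norm_num) h2 4
    norm_num at h3 h4
    linarith
  have h2 : (n : ℝ) ^ 2 ≤ Real.exp (2 * L) := by
    have h3 := Real.exp_nat_mul L 2
    rw [Real.exp_log hd'] at h3
    push_cast at h3
    rw [h3]
    gcongr
  calc 6 * ((2 * n : ℕ) : ℝ) ^ 2 * Real.exp (-(L ^ 2 / 8))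
      = 24 * (n : ℝ) ^ 2 * Real.exp (-(L ^ 2 / 8)) := by push_cast; ring
    _ ≤ Real.exp 4 * Real.exp (2 * L) * Real.exp (-(L ^ 2 / 8)) := by gcongr
    _ = Real.exp (4 + 2 * L + -(L ^ 2 / 8)) := by rw [Real.exp_add, Real.exp_add]
    -- `4 + 2 L ≤ L² / 16` holds from `L = 34` on.
    _ ≤ _ := Real.exp_le_exp.2 (by nlinarith)

theorem theorem3 :
    ∃ c κ γ η : ℝ, 0 < c ∧ 0 < κ ∧ 0 < γ ∧ 0 < η ∧
      ∀ K : ℝ, 0 < K →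
        ∃ (d₀ : ℕ) (r : ℕ → ℝ), r =o[atTop] (fun d : ℕ => 1 / √(d : ℝ)) ∧
          ∀ n d : ℕ, 1 ≤ n → d₀ ≤ d → K * (n : ℝ) ≤ (d : ℝ) / Real.log (d : ℝ) ^ 4 →
            ∀ X : Matrix (Fin n) (Fin d) ℝ, (∀ j, ‖WithLp.toLp 2 (X j)‖ = √(d : ℝ)) →
              ∃ A : Set (Matrix (Fin d) (Fin d) ℝ), MeasurableSet A ∧
                1 - Real.exp (-c * Real.log (d : ℝ) ^ 2) ≤ (gaussianMatrix d).real A ∧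
                ∀ W ∈ A,
                  ENNReal.ofReal κ ≤ wordSensitivity (raf W) X ∧
                  ∀ i : Fin n, ∃ Δ : EuclideanSpace ℝ (Fin d), ‖Δ‖ ≤ √(d : ℝ) ∧
                    (∃ J : Finset (Fin n), γ * (n : ℝ) ≤ (J.card : ℝ) ∧
                      ∀ j ∈ J,
                        ‖WithLp.toLp 2 (attentionScores W (perturb X i Δ) j - Pi.single i 1)‖
                          ≤ r d) ∧
                    η * √((d : ℝ) * (n : ℝ)) ≤ ‖raf W (perturb X i Δ) - raf W X‖ := by
  refine ⟨1 / 16, 1 / 30, 1 / 24, 1 / 30, by norm_num, by norm_num, by norm_num, by norm_num,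
    fun K hK => ?_⟩
  have hlog : Tendsto (fun d : ℕ => Real.log d) atTop atTop :=
    Real.tendsto_log_atTop.comp tendsto_natCast_atTop_atTop
  have hsK : 0 < √K := Real.sqrt_pos.2 hK
  -- In order, the conditions serve `t ≤ 1 / 12`, the union bound, the score gap with `q = √K`, `n ≤
  -- d`, and the numerical bounds.
  obtain ⟨d₀, hd₀⟩ := eventually_atTop.1 ((eventually_log_le_sqrt (ε := 1 / 12) (by norm_num)).and
    ((hlog.eventually_ge_atTop 34).and ((hlog.eventually_ge_atTop (26 / √K)).and
      ((hlog.eventually_ge_atTop (1 / K)).and (eventually_ge_atTop 24)))))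
  refine ⟨d₀, fun d => 1 / (d : ℝ), isLittleO_inv_inv_sqrt, fun n d hn hd hKn X hX => ?_⟩
  obtain ⟨hL12, hL34, hLK, hLK', hd24⟩ := hd₀ d hd
  have : NeZero n := ⟨by omega⟩
  have hdpos : 0 < d := by omega
  have hd0 : (0 : ℝ) < d := by exact_mod_cast hdpos
  have hsd : 0 < √(d : ℝ) := Real.sqrt_pos.2 hd0
  set L := Real.log (d : ℝ) with hL
  have hL0 : 0 < L := by linarith
  have hKnL : K * n * L ^ 4 ≤ d := (le_div_iff₀ (by positivity)).1 hKn
  have hnd : n ≤ d := by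
    have h1 : 1 ≤ K * L := by
      rw [div_le_iff₀ hK] at hLK'
      linarith
    have h2 : 1 ≤ K * L ^ 4 := by
      have : L ≤ L ^ 4 := le_self_pow₀ (by linarith) (by norm_num)
      nlinarith
    have h3 : (n : ℝ) ≤ d := by
      have : (0 : ℝ) ≤ n := Nat.cast_nonneg n
      nlinarith
    exact_mod_cast h3
  have hqn : √K * L ^ 2 * √(n : ℝ) ≤ √(d : ℝ) := by
    refine Real.le_sqrt_of_sq_le ?_
    rw [mul_pow, mul_pow, Real.sq_sqrt hK.le, Real.sq_sqrt (Nat.cast_nonneg n)]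
    linarith
  have hXX : ∀ j, X j ⬝ᵥ X j = d := fun j => by
    rw [← norm_toLp_sq, hX, Real.sq_sqrt hd0.le]
  set u : Fin n → Fin d → ℝ := fun j => (√(d : ℝ))⁻¹ • X j with hu
  have huu : ∀ j, u j ⬝ᵥ u j = 1 := fun j => by
    rw [hu, smul_dotProduct, dotProduct_smul, hXX, smul_eq_mul, smul_eq_mul, ← mul_assoc,
      ← mul_inv, Real.mul_self_sqrt hd0.le, inv_mul_cancel₀ hd0.ne']
  have hXu : ∀ j, X j = √(d : ℝ) • u j := fun j => by
    rw [hu, smul_smul, mul_inv_cancel₀ hsd.ne', one_smul]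
  choose z hz J hJc hJ using fun i => exists_unit_dotProduct_ge huu i
  set t := L / √(d : ℝ) with ht
  have ht0 : 0 ≤ t := by positivity
  have ht12 : t ≤ 1 / 12 := (div_le_iff₀ hsd).2 hL12
  -- One event for the `2 n` vectors handles every token `i` at once.
  set a : Fin n ⊕ Fin n → Fin d → ℝ := Sum.elim u z with ha
  refine ⟨gramEvent a t, measurableSet_gramEvent a t, ?_, fun W hW => ?_⟩
  · have h := measure_gramEvent_ge (a := a) (t := t) (by rintro (j | j) <;> simp [ha, huu, hz])
      ht0 (by linarith)
    have h1 : (d : ℝ) * t ^ 2 = L ^ 2 := by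
      rw [ht, div_pow, Real.sq_sqrt hd0.le]
      field_simp
    rw [h1, Fintype.card_sum, Fintype.card_fin, ← two_mul] at h
    have := union_bound_le_exp hnd hdpos hL34
    linarith
  · have key : ∀ i : Fin n, ∃ Δ : EuclideanSpace ℝ (Fin d), ‖Δ‖ ≤ √(d : ℝ) ∧
        (∀ j ∈ J i, ‖WithLp.toLp 2 (attentionScores W (perturb X i Δ) j - Pi.single i 1)‖ ≤
          1 / (d : ℝ)) ∧
        1 / 30 * √((d : ℝ) * n) ≤ ‖raf W (perturb X i Δ) - raf W X‖ := fun i =>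
      exists_perturbation hd24 hnd hL (div_mul_cancel₀ _ hsd.ne') ht12
        (by rw [div_le_iff₀ hsK] at hLK; linarith) hqn hXu (hJc i) (hJ i)
        (fun j => (hW (Sum.inl j) (Sum.inr i)).1)
        (by have h := (hW (Sum.inr i) (Sum.inr i)).1; rwa [ha, Sum.elim_inr, hz] at h)
        (fun j k => (hW (Sum.inl j) (Sum.inl k)).2)
        (fun k => (hW (Sum.inr i) (Sum.inl k)).2)
    refine ⟨?_, fun i => ?_⟩
    · obtain ⟨Δ, h1, -, h2⟩ := key 0
      exact wordSensitivity_raf_ge hXX h1 (by norm_num) hdpos h2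
    · obtain ⟨Δ, h1, h2, h3⟩ := key i
      exact ⟨Δ, h1, ⟨J i, by linarith [hJc i], h2⟩, h3⟩
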